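/- Let $a,b,p,q,c,d,s,t\geq 2$ be integers, and for $n \ge 2$ let $F_n$ denote the free group of rank $n$. Let $G_1=(F_a\times F_b)*(F_p\times F_q)$ and $G_2=(F_c\times F_d)*(F_s\times F_t)$, where $*$ denotes the free product of groups. If $$(a-1)(b-1)+(p-1)(q-1)=(c-1)(d-1)+(s-1)(t-1),$$ then $G_1$ and $G_2$ are commensurable, that is, there are subgroups $H_1\le G_1$ and $H_2\le G_2$ of finite index such that $H_1$ and $H_2$ are isomorphic. -/

import Mathlib

/-- Two groups are (abstractly) commensurable if they have isomorphic subgroups of finite index. -/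
def AbstractlyCommensurable (G H : Type*) [Group G] [Group H] : Prop :=
  ∃ (K : Subgroup G) (L : Subgroup H), K.FiniteIndex ∧ L.FiniteIndex ∧ Nonempty (K ≃* L)

/-- The free group of rank `n`. -/
abbrev FreeGroupOfRank (n : ℕ) : Type := FreeGroup (Fin n)

/-- The free product `(F_a × F_b) ∗ (F_p × F_q)` of two direct products of free groups. -/
abbrev FreeProdOfProducts (a b p q : ℕ) : Type :=
  Monoid.Coprod (FreeGroupOfRank a × FreeGroupOfRank b) (FreeGroupOfRank p × FreeGroupOfRank q)

/-! The two groups share a finite-index subgroup: a free product of copies of one `F_{x+1} ×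
F_{y+1}` and a free group. If `A₀ ≤ A`, `B₀ ≤ B` have indices `m`, `n`, the preimage of `A₀ × B₀`
under `A ∗ B → A × B` is, as in Kurosh's theorem, `n` copies of `A₀`, `m` copies of `B₀` and a free
group of rank `(m-1)(n-1)` (`embedsWithIndex_coprod_subgroups`). Write the ranks in `G_1` as `a+1,
b+1, p+1, q+1`. For suitable `x`, `y`, both factors contain `F_{x+1} × F_{y+1}`, with indices
`xy/(ab)` and `xy/(pq)`, so the preimage has `xy/(ab) + xy/(pq)` copies of it. A further cover of
degree `ab·pq`, unwinding one free generator (`coprodI_freeGroup`), makes this `xy(ab+pq)`. The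
total index is then `(xy)²`, and the free rank is also determined by `x`, `y` and `ab+pq`, as Euler
characteristics predict. Choosing `x`, `y` to suit `G_1` and `G_2` at once finishes the proof. -/

/-- `H` embeds in `G` as a subgroup of index `n`. -/
def EmbedsWithIndex (H G : Type*) [Group H] [Group G] (n : ℕ) : Prop :=
  ∃ f : H →* G, Function.Injective f ∧ f.range.index = n

namespace EmbedsWithIndex

variable {G H K G' H' : Type*} [Group G] [Group H] [Group K] [Group G'] [Group H'] {m n : ℕ}

theorem of_mulEquiv (e : H ≃* G) : EmbedsWithIndex H G 1 :=
  ⟨e.toMonoidHom, e.injective, by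
    rw [MonoidHom.range_eq_top.2 e.surjective, Subgroup.index_top]⟩

theorem trans (h₁ : EmbedsWithIndex K H m) (h₂ : EmbedsWithIndex H G n) :
    EmbedsWithIndex K G (m * n) := by
  obtain ⟨f, hf, rfl⟩ := h₁
  obtain ⟨g, hg, rfl⟩ := h₂
  exact ⟨g.comp f, hg.comp hf, by
    rw [MonoidHom.range_comp, Subgroup.index_map_of_injective _ hg]⟩

theorem congr_left (e : K ≃* H) (h : EmbedsWithIndex H G n) : EmbedsWithIndex K G n := by
  simpa using (of_mulEquiv e).trans h

theorem congr_right (h : EmbedsWithIndex H G n) (e : G ≃* K) : EmbedsWithIndex H K n := by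
  simpa using h.trans (of_mulEquiv e)

theorem prod (h₁ : EmbedsWithIndex H G m) (h₂ : EmbedsWithIndex H' G' n) :
    EmbedsWithIndex (H × H') (G × G') (m * n) := by
  obtain ⟨f, hf, rfl⟩ := h₁
  obtain ⟨g, hg, rfl⟩ := h₂
  refine ⟨f.prodMap g, hf.prodMap hg, ?_⟩
  rw [← Subgroup.index_prod]
  congr 1
  ext ⟨x, y⟩
  simp [Subgroup.mem_prod, MonoidHom.mem_range]

theorem exists_subgroup (h : EmbedsWithIndex H G n) :
    ∃ A : Subgroup G, A.index = n ∧ Nonempty (H ≃* A) := by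
  obtain ⟨f, hf, hn⟩ := h
  exact ⟨f.range, hn, ⟨MonoidHom.ofInjective hf⟩⟩

theorem abstractlyCommensurable (h₁ : EmbedsWithIndex K G m) (h₂ : EmbedsWithIndex K H n)
    (hm : m ≠ 0) (hn : n ≠ 0) : AbstractlyCommensurable G H := by
  obtain ⟨A, hA, ⟨e⟩⟩ := h₁.exists_subgroup
  obtain ⟨B, hB, ⟨e'⟩⟩ := h₂.exists_subgroup
  exact ⟨A, B, ⟨by rwa [hA]⟩, ⟨by rwa [hB]⟩, ⟨e.symm.trans e'⟩⟩

end EmbedsWithIndex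

/-- If the translates `t s * f h` exhaust `G` without repetition, then `f.range` has index
the number of translates. -/
theorem index_range_of_bijective {S H G : Type*} [Group H] [Group G] (f : H →* G) (t : S → G)
    (h : Function.Bijective fun p : S × H => t p.1 * f p.2) : f.range.index = Nat.card S := by
  refine (Nat.card_eq_of_bijective (fun s : S => (t s : G ⧸ f.range)) ⟨?_, ?_⟩).symm
  · intro s s' hs
    obtain ⟨k, hk⟩ := QuotientGroup.eq.1 hs
    have : (s, k) = (s', 1) := h.1 (by simp [hk])
    exact congrArg Prod.fst this
  · intro q
    obtain ⟨g, rfl⟩ := QuotientGroup.mk_surjective q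
    obtain ⟨⟨s, k⟩, rfl⟩ := h.2 g
    exact ⟨s, QuotientGroup.eq.2 ⟨k, by simp⟩⟩

/-! ### Coset representatives and their cocycle -/

section Cocycle

variable {A : Type*} [Group A] {A₀ : Subgroup A}

/-- The cocycle of the action of `A` on `A ⧸ A₀` given by a choice `r` of representatives. -/
def repCocycle (r : A ⧸ A₀ → A) (hr : ∀ x, (r x : A ⧸ A₀) = x) (a : A) (x : A ⧸ A₀) : A₀ :=
  ⟨(r (a • x))⁻¹ * (a * r x), QuotientGroup.eq.1 <| by
    rw [hr, ← smul_eq_mul, ← MulAction.Quotient.smul_coe, hr]⟩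

variable (r : A ⧸ A₀ → A) (hr : ∀ x, (r x : A ⧸ A₀) = x)

theorem repCocycle_one (x : A ⧸ A₀) : repCocycle r hr 1 x = 1 := by
  ext; simp [repCocycle]

theorem repCocycle_mul (a b : A) (x : A ⧸ A₀) :
    repCocycle r hr (a * b) x = repCocycle r hr a (b • x) * repCocycle r hr b x := by
  ext; simp [repCocycle, mul_smul]; group

theorem rep_smul_base (r : A ⧸ A₀ → A) (hr : ∀ x, (r x : A ⧸ A₀) = x) (x : A ⧸ A₀) :
    r x • ((1 : A) : A ⧸ A₀) = x := by
  rw [MulAction.Quotient.smul_coe, smul_eq_mul, mul_one, hr]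

theorem repCocycle_rep (h1 : r (1 : A) = 1) (x : A ⧸ A₀) :
    repCocycle r hr (r x) (1 : A) = 1 := by
  ext; simp only [repCocycle, rep_smul_base r hr, h1]; simp

theorem coe_smul_base (a : A₀) : (a : A) • ((1 : A) : A ⧸ A₀) = (1 : A) := by
  rw [MulAction.Quotient.smul_coe, smul_eq_mul, mul_one]
  exact (QuotientGroup.eq.2 (by simp)).symm

theorem repCocycle_coe (h1 : r (1 : A) = 1) (a : A₀) :
    repCocycle r hr a (1 : A) = a := by
  ext; simp only [repCocycle, coe_smul_base, h1]; simp

/-- The normalization at the trivial coset keeps the base point of the twisted action free of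
correction terms. -/
theorem exists_rep (A₀ : Subgroup A) :
    ∃ r : A ⧸ A₀ → A, (∀ x, (r x : A ⧸ A₀) = x) ∧ r (1 : A) = 1 := by
  classical
  refine ⟨Function.update Quotient.out ((1 : A) : A ⧸ A₀) 1, fun x => ?_, by simp⟩
  by_cases h : x = ((1 : A) : A ⧸ A₀)
  · subst h; simp
  · rw [Function.update_of_ne h]; exact QuotientGroup.out_eq' x

end Cocycle

/-! ### The action of `A ∗ B` that detects the subgroup -/

section TwistedAction

variable {A B H : Type*} [Group A] [Group B] [Group H] {A₀ : Subgroup A} {B₀ : Subgroup B}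
  (r : A ⧸ A₀ → A) (hr : ∀ x, (r x : A ⧸ A₀) = x)
  (r' : B ⧸ B₀ → B) (hr' : ∀ y, (r' y : B ⧸ B₀) = y)
  (j : B ⧸ B₀ → A₀ →* H) (j' : A ⧸ A₀ → B₀ →* H) (e : A ⧸ A₀ → B ⧸ B₀ → H)

/-- The action of `A` on `A ⧸ A₀ × B ⧸ B₀ × H` twisted by the cocycle with values in `A₀`. -/
def leftTwistedAction : A →* Function.End ((A ⧸ A₀) × (B ⧸ B₀) × H) where
  toFun a p := (a • p.1, p.2.1, j p.2.1 (repCocycle r hr a p.1) * p.2.2)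
  map_one' := by
    funext p
    simp [repCocycle_one]
    rfl
  map_mul' a b := by
    funext p
    simp [repCocycle_mul, mul_smul, mul_assoc]
    rfl

/-- The action of `B` on `A ⧸ A₀ × B ⧸ B₀ × H` twisted by the cocycle with values in `B₀` and
by the edge labels `e`. -/
def rightTwistedAction : B →* Function.End ((A ⧸ A₀) × (B ⧸ B₀) × H) where
  toFun b p := (p.1, b • p.2.1,
    (e p.1 (b • p.2.1))⁻¹ * (j' p.1 (repCocycle r' hr' b p.2.1) * (e p.1 p.2.1 * p.2.2)))
  map_one' := by
    funext p
    simp [repCocycle_one]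
    rfl
  map_mul' a b := by
    funext p
    change _ = (p.1, a • b • p.2.1, (e p.1 (a • b • p.2.1))⁻¹ *
      (j' p.1 (repCocycle r' hr' a (b • p.2.1)) * (e p.1 (b • p.2.1) * ((e p.1 (b • p.2.1))⁻¹ *
        (j' p.1 (repCocycle r' hr' b p.2.1) * (e p.1 p.2.1 * p.2.2))))))
    simp [repCocycle_mul, mul_smul, mul_assoc]

/-- The action of the free product of `A` and `B` on `A ⧸ A₀ × B ⧸ B₀ × H`. -/
def twistedAction : Monoid.Coprod A B →* Function.End ((A ⧸ A₀) × (B ⧸ B₀) × H) :=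
  Monoid.Coprod.lift (leftTwistedAction r hr j) (rightTwistedAction r' hr' j' e)

local notation "Φ" => twistedAction r hr r' hr' j j' e

theorem twistedAction_inl (a : A) (x : A ⧸ A₀) (y : B ⧸ B₀) (h : H) :
    Φ (Monoid.Coprod.inl a) (x, y, h) = (a • x, y, j y (repCocycle r hr a x) * h) := by
  rw [twistedAction, Monoid.Coprod.lift_apply_inl]
  rfl

theorem twistedAction_inr (b : B) (x : A ⧸ A₀) (y : B ⧸ B₀) (h : H) :
    Φ (Monoid.Coprod.inr b) (x, y, h) =
      (x, b • y, (e x (b • y))⁻¹ * (j' x (repCocycle r' hr' b y) * (e x y * h))) := by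
  rw [twistedAction, Monoid.Coprod.lift_apply_inr]
  rfl

theorem twistedAction_mul (g k : Monoid.Coprod A B) (p) : Φ (g * k) p = Φ g (Φ k p) := by
  rw [map_mul]; rfl

theorem twistedAction_inv (g : Monoid.Coprod A B) {p q} (h : Φ g p = q) : Φ g⁻¹ q = p := by
  rw [← h, ← twistedAction_mul, inv_mul_cancel, map_one]; rfl

variable (f : H →* Monoid.Coprod A B)

/-- A map `A ⧸ A₀ × B ⧸ B₀ × H → A ∗ B` which is equivariant for `twistedAction`. -/
theorem equivariant_twistedAction
    (hj : ∀ y a, f (j y a) =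
      (Monoid.Coprod.inr (r' y))⁻¹ * Monoid.Coprod.inl (a : A) * Monoid.Coprod.inr (r' y))
    (hj' : ∀ x b, f (j' x b) =
      (Monoid.Coprod.inl (r x))⁻¹ * Monoid.Coprod.inr (b : B) * Monoid.Coprod.inl (r x))
    (he : ∀ x y, f (e x y) =
      (Monoid.Coprod.inr (r' y) * Monoid.Coprod.inl (r x))⁻¹ *
        (Monoid.Coprod.inl (r x) * Monoid.Coprod.inr (r' y)))
    (g : Monoid.Coprod A B) (p : (A ⧸ A₀) × (B ⧸ B₀) × H) :
    Monoid.Coprod.inl (r (Φ g p).1) * Monoid.Coprod.inr (r' (Φ g p).2.1) * f (Φ g p).2.2 =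
      g * (Monoid.Coprod.inl (r p.1) * Monoid.Coprod.inr (r' p.2.1) * f p.2.2) := by
  induction g using Monoid.Coprod.induction_on generalizing p with
  | inl a =>
    obtain ⟨x, y, h⟩ := p
    simp only [twistedAction_inl, map_mul, hj, repCocycle, map_inv]
    group
  | inr b =>
    obtain ⟨x, y, h⟩ := p
    simp only [twistedAction_inr, map_mul, hj', he, repCocycle, map_inv]
    group
  | mul g k hg hk => rw [twistedAction_mul, hg, hk, mul_assoc g k]

theorem twistedAction_inl_rep (h1 : r (1 : A) = 1) (x : A ⧸ A₀) (y : B ⧸ B₀) (h : H) :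
    Φ (Monoid.Coprod.inl (r x)) ((1 : A), y, h) = (x, y, h) := by
  rw [twistedAction_inl, repCocycle_rep r hr h1, rep_smul_base r hr, map_one, one_mul]

theorem twistedAction_inr_rep (h1' : r' (1 : B) = 1) (he1' : ∀ x, e x (1 : B) = 1)
    (x : A ⧸ A₀) (y : B ⧸ B₀) (h : H) :
    Φ (Monoid.Coprod.inr (r' y)) (x, (1 : B), h) = (x, y, (e x y)⁻¹ * h) := by
  rw [twistedAction_inr, repCocycle_rep r' hr' h1', rep_smul_base r' hr', map_one, one_mul,
    he1', one_mul]

/-- Move from the base point to `(1, y)` with trivial label, act there by `a`, and return the same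
way. -/
theorem twistedAction_vertex_left (h1 : r (1 : A) = 1) (h1' : r' (1 : B) = 1)
    (he1 : ∀ y, e (1 : A) y = 1) (he1' : ∀ x, e x (1 : B) = 1)
    (y : B ⧸ B₀) (a : A₀) (h : H) :
    Φ ((Monoid.Coprod.inr (r' y))⁻¹ * Monoid.Coprod.inl (a : A) * Monoid.Coprod.inr (r' y))
      (((1 : A) : A ⧸ A₀), ((1 : B) : B ⧸ B₀), h) =
        (((1 : A) : A ⧸ A₀), ((1 : B) : B ⧸ B₀), j y a * h) := by
  rw [twistedAction_mul, twistedAction_mul, twistedAction_inr_rep _ _ _ _ _ _ _ h1' he1',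
    twistedAction_inl, coe_smul_base, repCocycle_coe r hr h1, he1, inv_one, one_mul]
  apply twistedAction_inv
  rw [twistedAction_inr_rep _ _ _ _ _ _ _ h1' he1', he1, inv_one, one_mul]

theorem twistedAction_vertex_right (h1 : r (1 : A) = 1) (h1' : r' (1 : B) = 1)
    (he1' : ∀ x, e x (1 : B) = 1) (x : A ⧸ A₀) (b : B₀) (h : H) :
    Φ ((Monoid.Coprod.inl (r x))⁻¹ * Monoid.Coprod.inr (b : B) * Monoid.Coprod.inl (r x))
      (((1 : A) : A ⧸ A₀), ((1 : B) : B ⧸ B₀), h) =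
        (((1 : A) : A ⧸ A₀), ((1 : B) : B ⧸ B₀), j' x b * h) := by
  rw [twistedAction_mul, twistedAction_mul, twistedAction_inl_rep _ _ _ _ _ _ _ h1,
    twistedAction_inr, coe_smul_base, repCocycle_coe r' hr' h1', he1', inv_one, one_mul, one_mul]
  exact twistedAction_inv _ _ _ _ _ _ _ _ (twistedAction_inl_rep _ _ _ _ _ _ _ h1 _ _ _)

/-- The two routes from `(1, 1)` to `(x, y)`, changing `y` first or `x` first, differ exactly by the
label `e x y`. -/
theorem twistedAction_edge (h1 : r (1 : A) = 1) (h1' : r' (1 : B) = 1)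
    (he1 : ∀ y, e (1 : A) y = 1) (he1' : ∀ x, e x (1 : B) = 1)
    (x : A ⧸ A₀) (y : B ⧸ B₀) (h : H) :
    Φ ((Monoid.Coprod.inr (r' y) * Monoid.Coprod.inl (r x))⁻¹ *
        (Monoid.Coprod.inl (r x) * Monoid.Coprod.inr (r' y)))
      (((1 : A) : A ⧸ A₀), ((1 : B) : B ⧸ B₀), h) =
        (((1 : A) : A ⧸ A₀), ((1 : B) : B ⧸ B₀), e x y * h) := by
  rw [twistedAction_mul]
  apply twistedAction_inv
  rw [twistedAction_mul, twistedAction_mul, twistedAction_inl_rep _ _ _ _ _ _ _ h1,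
    twistedAction_inr_rep _ _ _ _ _ _ _ h1' he1', twistedAction_inr_rep _ _ _ _ _ _ _ h1' he1',
    twistedAction_inl_rep _ _ _ _ _ _ _ h1, he1, inv_mul_cancel_left, inv_one, one_mul]

/-- A homomorphism `f : H → A ∗ B` compatible with `twistedAction` is an embedding of index
`[A : A₀] * [B : B₀]`. -/
theorem embedsWithIndex_of_twistedAction (h1 : r (1 : A) = 1) (h1' : r' (1 : B) = 1)
    (he1' : ∀ x, e x (1 : B) = 1)
    (hj : ∀ y a, f (j y a) =
      (Monoid.Coprod.inr (r' y))⁻¹ * Monoid.Coprod.inl (a : A) * Monoid.Coprod.inr (r' y))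
    (hj' : ∀ x b, f (j' x b) =
      (Monoid.Coprod.inl (r x))⁻¹ * Monoid.Coprod.inr (b : B) * Monoid.Coprod.inl (r x))
    (he : ∀ x y, f (e x y) =
      (Monoid.Coprod.inr (r' y) * Monoid.Coprod.inl (r x))⁻¹ *
        (Monoid.Coprod.inl (r x) * Monoid.Coprod.inr (r' y)))
    (hf : ∀ k h, Φ (f k) (((1 : A) : A ⧸ A₀), ((1 : B) : B ⧸ B₀), h) =
      (((1 : A) : A ⧸ A₀), ((1 : B) : B ⧸ B₀), k * h)) :
    EmbedsWithIndex H (Monoid.Coprod A B) (A₀.index * B₀.index) := by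
  have hinj : Function.Injective f := by
    refine (injective_iff_map_eq_one f).2 fun k hk => ?_
    have := hf k 1
    rw [hk, map_one, mul_one] at this
    exact (congrArg (fun p => p.2.2) this).symm
  refine ⟨f, hinj, ?_⟩
  rw [Subgroup.index.eq_1 A₀, Subgroup.index.eq_1 B₀, ← Nat.card_prod]
  let t : (A ⧸ A₀) × (B ⧸ B₀) → Monoid.Coprod A B :=
    fun s => Monoid.Coprod.inl (r s.1) * Monoid.Coprod.inr (r' s.2)
  refine index_range_of_bijective f t ⟨?_, fun g => ?_⟩
  -- The image of the base point under `t (x, y) * f k` determines `x`, `y` and `k`.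
  · have key : ∀ (x : A ⧸ A₀) (y : B ⧸ B₀) (k : H),
        Φ (t (x, y) * f k) (((1 : A) : A ⧸ A₀), ((1 : B) : B ⧸ B₀), 1) =
          (x, y, (e (1 : A) y)⁻¹ * k) := by
      intro x y k
      rw [twistedAction_mul, hf, twistedAction_mul, twistedAction_inr_rep _ _ _ _ _ _ _ h1' he1',
        twistedAction_inl_rep _ _ _ _ _ _ _ h1, mul_one]
    rintro ⟨⟨x, y⟩, k⟩ ⟨⟨x', y'⟩, k'⟩ hp
    have h2 := (key x y k).symm.trans ((congrArg (fun g => Φ g _) hp).trans (key x' y' k'))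
    simp only [Prod.mk.injEq] at h2
    obtain ⟨rfl, rfl, h3⟩ := h2
    rw [mul_left_cancel h3]
  -- Equivariance at the base point, which maps to `1`, factors `g` as a translate times a value of
  -- `f`.
  · have := equivariant_twistedAction r hr r' hr' j j' e f hj hj' he g
      (((1 : A) : A ⧸ A₀), ((1 : B) : B ⧸ B₀), 1)
    rw [h1, h1', map_one, map_one, map_one, mul_one, mul_one, mul_one] at this
    exact ⟨⟨((Φ g _).1, (Φ g _).2.1), (Φ g _).2.2⟩, this⟩

end TwistedAction

/-! ### The Kurosh decomposition of the preimage of `A₀ × B₀` -/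

open Monoid in
/-- The free product of copies of `A₀` indexed by the cosets of `B₀`, copies of `B₀` indexed by the
cosets of `A₀` and a free group on the pairs of nontrivial cosets. -/
abbrev CosetCoprod {A B : Type*} [Group A] [Group B] (A₀ : Subgroup A) (B₀ : Subgroup B) : Type _ :=
  Coprod (Coprod (CoprodI fun _ : B ⧸ B₀ => A₀) (CoprodI fun _ : A ⧸ A₀ => B₀))
        (FreeGroup ({x : A ⧸ A₀ // x ≠ (1 : A)} × {y : B ⧸ B₀ // y ≠ (1 : B)}))

open Monoid in
/-- The preimage of `A₀ × B₀` under `A ∗ B → A × B` is a free product of copies of `A₀`, copies of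
`B₀` and a free group. -/
theorem embedsWithIndex_coprod_subgroups {A B : Type*} [Group A] [Group B] (A₀ : Subgroup A)
    (B₀ : Subgroup B) :
    EmbedsWithIndex (CosetCoprod A₀ B₀) (Coprod A B) (A₀.index * B₀.index) := by
  classical
  obtain ⟨r, hr, h1⟩ := exists_rep A₀
  obtain ⟨r', hr', h1'⟩ := exists_rep B₀
  let c (x : A ⧸ A₀) (y : B ⧸ B₀) : Coprod A B :=
    (Coprod.inr (r' y) * Coprod.inl (r x))⁻¹ * (Coprod.inl (r x) * Coprod.inr (r' y))
  let f : CosetCoprod A₀ B₀ →* Coprod A B :=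
    Coprod.lift
      (Coprod.lift
        (CoprodI.lift fun y => ((MulAut.conj (Coprod.inr (r' y))⁻¹).toMonoidHom.comp
          (Coprod.inl : A →* Coprod A B)).comp A₀.subtype)
        (CoprodI.lift fun x => ((MulAut.conj (Coprod.inl (r x))⁻¹).toMonoidHom.comp
          (Coprod.inr : B →* Coprod A B)).comp B₀.subtype))
      (FreeGroup.lift fun p => c p.1 p.2)
  let j (y : B ⧸ B₀) : A₀ →* CosetCoprod A₀ B₀ :=
    Coprod.inl.comp <| Coprod.inl.comp (CoprodI.of (M := fun _ : B ⧸ B₀ => A₀) (i := y))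
  let j' (x : A ⧸ A₀) : B₀ →* CosetCoprod A₀ B₀ :=
    Coprod.inl.comp <| Coprod.inr.comp (CoprodI.of (M := fun _ : A ⧸ A₀ => B₀) (i := x))
  -- The pairs `(x, y)` are the edges of a complete bipartite graph; those with a trivial coset form
  -- a spanning tree and get label `1`, the others are free generators.
  let e (x : A ⧸ A₀) (y : B ⧸ B₀) : CosetCoprod A₀ B₀ :=
    if h : x ≠ (1 : A) ∧ y ≠ (1 : B) then Coprod.inr (FreeGroup.of (⟨x, h.1⟩, ⟨y, h.2⟩)) else 1
  have he1 : ∀ y, e (1 : A) y = 1 := fun y => dif_neg (by simp)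
  have he1' : ∀ x, e x (1 : B) = 1 := fun x => dif_neg (by simp)
  have hj : ∀ y a, f (j y a) =
      (Coprod.inr (r' y))⁻¹ * Coprod.inl (a : A) * Coprod.inr (r' y) := by
    intro y a; simp [f, j]
  have hj' : ∀ x b, f (j' x b) =
      (Coprod.inl (r x))⁻¹ * Coprod.inr (b : B) * Coprod.inl (r x) := by
    intro x b; simp [f, j']
  have he : ∀ x y, f (e x y) = c x y := by
    intro x y
    by_cases hx : x = (1 : A)
    · subst hx; simp [he1, c, h1]
    by_cases hy : y = (1 : B)
    · subst hy; simp [he1', c, h1']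
    simp [f, e, hx, hy]
  refine embedsWithIndex_of_twistedAction r hr r' hr' j j' e f h1 h1' he1' hj hj' he ?_
  intro k
  -- The required identity is multiplicative in `k`, so it reduces to generators.
  have hmul : ∀ k k', (∀ h, twistedAction r hr r' hr' j j' e (f k)
      (((1 : A) : A ⧸ A₀), ((1 : B) : B ⧸ B₀), h) =
        (((1 : A) : A ⧸ A₀), ((1 : B) : B ⧸ B₀), k * h)) →
      (∀ h, twistedAction r hr r' hr' j j' e (f k') (((1 : A) : A ⧸ A₀), ((1 : B) : B ⧸ B₀), h) =
        (((1 : A) : A ⧸ A₀), ((1 : B) : B ⧸ B₀), k' * h)) →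
      ∀ h, twistedAction r hr r' hr' j j' e (f (k * k'))
          (((1 : A) : A ⧸ A₀), ((1 : B) : B ⧸ B₀), h) =
        (((1 : A) : A ⧸ A₀), ((1 : B) : B ⧸ B₀), k * k' * h) := by
    intro k k' hk hk' h
    rw [map_mul, twistedAction_mul, hk', hk, mul_assoc]
  have hone : ∀ h, twistedAction r hr r' hr' j j' e (f 1)
      (((1 : A) : A ⧸ A₀), ((1 : B) : B ⧸ B₀), h) =
        (((1 : A) : A ⧸ A₀), ((1 : B) : B ⧸ B₀), 1 * h) := by
    intro h; rw [map_one, map_one, one_mul]; rfl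
  induction k using Coprod.induction_on with
  | mul k k' hk hk' => exact hmul k k' hk hk'
  | inl k =>
    induction k using Coprod.induction_on with
    | mul k k' hk hk' => rw [map_mul]; exact hmul _ _ hk hk'
    | inl k =>
      induction k using CoprodI.induction_on with
      | one => simpa only [map_one] using hone
      | mul k k' hk hk' => rw [map_mul, map_mul]; exact hmul _ _ hk hk'
      | of y a =>
        intro h
        have := twistedAction_vertex_left r hr r' hr' j j' e h1 h1' he1 he1' y a h
        rwa [← hj] at this
    | inr k =>
      induction k using CoprodI.induction_on with
      | one => simpa only [map_one] using hone
      | mul k k' hk hk' => rw [map_mul, map_mul]; exact hmul _ _ hk hk'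
      | of x b =>
        intro h
        have := twistedAction_vertex_right r hr r' hr' j j' e h1 h1' he1' x b h
        rwa [← hj'] at this
  | inr k =>
    have hof : ∀ p h, twistedAction r hr r' hr' j j' e (f (Coprod.inr (FreeGroup.of p)))
        (((1 : A) : A ⧸ A₀), ((1 : B) : B ⧸ B₀), h) =
          (((1 : A) : A ⧸ A₀), ((1 : B) : B ⧸ B₀), Coprod.inr (FreeGroup.of p) * h) := by
      rintro ⟨⟨x, hx⟩, ⟨y, hy⟩⟩ h
      have := twistedAction_edge r hr r' hr' j j' e h1 h1' he1 he1' x y h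
      have hexy : e x y = Coprod.inr (FreeGroup.of (⟨x, hx⟩, ⟨y, hy⟩)) := dif_pos ⟨hx, hy⟩
      change twistedAction r hr r' hr' j j' e (c x y) _ = _ at this
      rwa [← he, hexy] at this
    induction k using FreeGroup.induction_on with
    | C1 => simpa only [map_one] using hone
    | of p => exact hof p
    | inv_of p _ =>
      intro h
      rw [map_inv, map_inv]
      apply twistedAction_inv
      rw [hof, mul_inv_cancel_left]
    | mul k k' hk hk' => rw [map_mul]; exact hmul _ _ hk hk'

/-! ### Regrouping free products -/

open Monoid in
/-- A free product of copies of one group depends only on the group and the number of copies. -/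
def coprodICongr {ι κ M N : Type*} [Monoid M] [Monoid N] (σ : ι ≃ κ) (e : M ≃* N) :
    (CoprodI fun _ : ι => M) ≃* (CoprodI fun _ : κ => N) :=
  MonoidHom.toMulEquiv
    (CoprodI.lift fun i => (CoprodI.of (M := fun _ : κ => N) (i := σ i)).comp e.toMonoidHom)
    (CoprodI.lift fun k =>
      (CoprodI.of (M := fun _ : ι => M) (i := σ.symm k)).comp e.symm.toMonoidHom)
    (by
      ext i x
      simp only [MonoidHom.comp_apply, CoprodI.lift_of, MonoidHom.id_apply,
        MulEquiv.toMonoidHom_eq_coe, MonoidHom.coe_coe, MulEquiv.symm_apply_apply]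
      rw [σ.symm_apply_apply])
    (by
      ext i x
      simp only [MonoidHom.comp_apply, CoprodI.lift_of, MonoidHom.id_apply,
        MulEquiv.toMonoidHom_eq_coe, MonoidHom.coe_coe, MulEquiv.apply_symm_apply]
      rw [σ.apply_symm_apply])

open Monoid in
/-- Free products over a disjoint union of index types. -/
def coprodISum (ι κ M : Type*) [Monoid M] :
    Coprod (CoprodI fun _ : ι => M) (CoprodI fun _ : κ => M) ≃* (CoprodI fun _ : ι ⊕ κ => M) :=
  MonoidHom.toMulEquiv
    (Coprod.lift (CoprodI.lift fun i => CoprodI.of (M := fun _ : ι ⊕ κ => M) (i := Sum.inl i))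
      (CoprodI.lift fun k => CoprodI.of (M := fun _ : ι ⊕ κ => M) (i := Sum.inr k)))
    (CoprodI.lift fun s => Sum.rec
      (fun i => Coprod.inl.comp (CoprodI.of (M := fun _ : ι => M) (i := i)))
      (fun k => Coprod.inr.comp (CoprodI.of (M := fun _ : κ => M) (i := k))) s)
    (by ext <;> simp)
    (by ext (i | k) x <;> simp)

open Monoid in
/-- The free product of a single group. -/
def coprodIUnique (ι M : Type*) [Unique ι] [Monoid M] : (CoprodI fun _ : ι => M) ≃* M :=
  MonoidHom.toMulEquiv (CoprodI.lift fun _ => MonoidHom.id M)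
    (CoprodI.of (M := fun _ : ι => M) (i := default))
    (by
      ext i x
      obtain rfl := Unique.eq_default i
      simp)
    (by ext; simp)

open Monoid in
/-- The free product of two free groups is free. -/
def coprodFreeGroup (ι κ : Type*) :
    Coprod (FreeGroup ι) (FreeGroup κ) ≃* FreeGroup (ι ⊕ κ) :=
  MonoidHom.toMulEquiv
    (Coprod.lift (FreeGroup.map Sum.inl) (FreeGroup.map Sum.inr))
    (FreeGroup.lift fun s => Sum.rec (fun i => Coprod.inl (FreeGroup.of i))
      (fun k => Coprod.inr (FreeGroup.of k)) s)
    (by ext <;> simp)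
    (by ext (i | k) <;> simp)

open Monoid in
/-- A free product of copies of `(∗ M) ∗ FreeGroup κ`, regrouped. -/
def coprodICoprodFreeGroup (γ ι κ M : Type*) [Group M] :
    (CoprodI fun _ : γ => Coprod (CoprodI fun _ : ι => M) (FreeGroup κ)) ≃*
      Coprod (CoprodI fun _ : γ × ι => M) (FreeGroup (γ × κ)) :=
  MonoidHom.toMulEquiv
    (CoprodI.lift fun c => Coprod.map
      (CoprodI.lift fun i => CoprodI.of (M := fun _ : γ × ι => M) (i := (c, i)))
      (FreeGroup.map fun k => (c, k)))
    (Coprod.lift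
      (CoprodI.lift fun p =>
        (CoprodI.of (M := fun _ : γ => Coprod (CoprodI fun _ : ι => M) (FreeGroup κ))
          (i := p.1)).comp (Coprod.inl.comp (CoprodI.of (M := fun _ : ι => M) (i := p.2))))
      (FreeGroup.lift fun p =>
        CoprodI.of (M := fun _ : γ => Coprod (CoprodI fun _ : ι => M) (FreeGroup κ))
          (i := p.1) (Coprod.inr (FreeGroup.of p.2))))
    (by ext <;> simp)
    (by ext <;> simp)

/-! ### Finite-index subgroups of free products and free groups -/

namespace EmbedsWithIndex

open Monoid

/-- If `H` and `K` embed in `A` and `B` with index `m` and `n`, then a free product of `n` copies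
of `H`, `m` copies of `K` and a free group of rank `(m - 1) * (n - 1)` embeds in `A ∗ B` with
index `m * n`. -/
theorem coprod {A B H K : Type*} [Group A] [Group B] [Group H] [Group K] {m n : ℕ}
    (h₁ : EmbedsWithIndex H A m) (h₂ : EmbedsWithIndex K B n) (hm : m ≠ 0) (hn : n ≠ 0) :
    EmbedsWithIndex
      (Coprod (Coprod (CoprodI fun _ : Fin n => H) (CoprodI fun _ : Fin m => K))
        (FreeGroup (Fin ((m - 1) * (n - 1)))))
      (Coprod A B) (m * n) := by
  classical
  obtain ⟨A₀, rfl, ⟨e⟩⟩ := h₁.exists_subgroup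
  obtain ⟨B₀, rfl, ⟨e'⟩⟩ := h₂.exists_subgroup
  have : Finite (A ⧸ A₀) := Nat.finite_of_card_ne_zero hm
  have : Finite (B ⧸ B₀) := Nat.finite_of_card_ne_zero hn
  have := Fintype.ofFinite (A ⧸ A₀)
  have := Fintype.ofFinite (B ⧸ B₀)
  have σ : Fin ((A₀.index - 1) * (B₀.index - 1)) ≃
      {x : A ⧸ A₀ // x ≠ (1 : A)} × {y : B ⧸ B₀ // y ≠ (1 : B)} := by
    refine (Fintype.equivFinOfCardEq ?_).symm
    rw [Fintype.card_prod, Fintype.card_subtype_compl, Fintype.card_subtype_compl,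
      Fintype.card_subtype_eq, Fintype.card_subtype_eq, Subgroup.index, Subgroup.index,
      Nat.card_eq_fintype_card, Nat.card_eq_fintype_card]
  refine (embedsWithIndex_coprod_subgroups A₀ B₀).congr_left ?_
  exact MulEquiv.coprodCongr (MulEquiv.coprodCongr
    (coprodICongr (Finite.equivFin (B ⧸ B₀)).symm e)
    (coprodICongr (Finite.equivFin (A ⧸ A₀)).symm e')) (FreeGroup.freeGroupCongr σ)

theorem coprod_left {A B H : Type*} [Group A] [Group B] [Group H] {m : ℕ}
    (h : EmbedsWithIndex H A m) (hm : m ≠ 0) :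
    EmbedsWithIndex (Coprod H (CoprodI fun _ : Fin m => B)) (Coprod A B) m := by
  -- Index `1` in `B` leaves a single copy of `H` and kills the free part.
  have h' := h.coprod (of_mulEquiv (MulEquiv.refl B)) hm one_ne_zero
  rw [show (m - 1) * (1 - 1) = 0 by simp, mul_one] at h'
  have e : FreeGroup (Fin 0) ≃* PUnit.{1} := MulEquiv.ofUnique
  have e₁ := MulEquiv.coprodCongr (coprodIUnique (Fin 1) H)
    (MulEquiv.refl (CoprodI fun _ : Fin m => B))
  have e₂ := (MulEquiv.coprodCongr e₁ e).trans (MulEquiv.coprodPUnit _)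
  exact h'.congr_left e₂.symm

theorem freeGroup_unit {m : ℕ} (hm : m ≠ 0) :
    EmbedsWithIndex (FreeGroup Unit) (FreeGroup Unit) m := by
  have e : FreeGroup Unit ≃* Multiplicative ℤ := FreeGroup.mulEquivIntOfUnique
  suffices h : EmbedsWithIndex (Multiplicative ℤ) (Multiplicative ℤ) m from
    (h.congr_left e).congr_right e.symm
  refine ⟨zpowersHom _ (Multiplicative.ofAdd (m : ℤ)), ?_, ?_⟩
  · intro a b hab
    have : a.toAdd * (m : ℤ) = b.toAdd * m := by
      simpa using congrArg Multiplicative.toAdd hab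
    exact Multiplicative.toAdd.injective (mul_right_cancel₀ (by exact_mod_cast hm) this)
  · have : (zpowersHom _ (Multiplicative.ofAdd (m : ℤ))).range =
        AddSubgroup.toSubgroup (AddSubgroup.zmultiples (m : ℤ)) := by
      ext x
      rfl
    rw [this, AddSubgroup.index_toSubgroup, Int.index_zmultiples, Int.natAbs_natCast]

/-- Absorbing an infinite cyclic free factor into a free group. -/
def freeGroupUnitCoprod (M κ : Type*) [Group M] :
    Coprod (FreeGroup Unit) (Coprod M (FreeGroup κ)) ≃* Coprod M (FreeGroup (κ ⊕ Unit)) :=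
  (MulEquiv.coprodComm _ _).trans ((MulEquiv.coprodAssoc _ _ _).trans
    (MulEquiv.coprodCongr (MulEquiv.refl _) (coprodFreeGroup _ _)))

/-- Split off one free generator as a factor `ℤ` and pass to `gℤ`: the complementary factor is
repeated `g` times and one cyclic factor survives, whence the `+ 1`. -/
theorem coprodI_freeGroup (M : Type*) [Group M] (n r : ℕ) {g : ℕ} (hg : g ≠ 0) :
    EmbedsWithIndex (Coprod (CoprodI fun _ : Fin (g * n) => M) (FreeGroup (Fin (g * r + 1))))
      (Coprod (CoprodI fun _ : Fin n => M) (FreeGroup (Fin (r + 1)))) g := by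
  have h := (freeGroup_unit hg).coprod_left
    (B := Coprod (CoprodI fun _ : Fin n => M) (FreeGroup (Fin r))) hg
  have e : (Fin r ⊕ Unit) ≃ Fin (r + 1) := Fintype.equivOfCardEq (by simp)
  have e' : Fin (g * r + 1) ≃ (Fin g × Fin r) ⊕ Unit := Fintype.equivOfCardEq (by simp)
  refine (h.congr_left ?_).congr_right ((freeGroupUnitCoprod _ _).trans
    (MulEquiv.coprodCongr (MulEquiv.refl _) (FreeGroup.freeGroupCongr e)))
  exact (MulEquiv.coprodCongr (coprodICongr finProdFinEquiv.symm (MulEquiv.refl M))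
    (FreeGroup.freeGroupCongr e')).trans ((freeGroupUnitCoprod _ _).symm.trans
      (MulEquiv.coprodCongr (MulEquiv.refl _) (coprodICoprodFreeGroup _ _ _ _).symm))

theorem freeGroup (r : ℕ) {g : ℕ} (hg : g ≠ 0) :
    EmbedsWithIndex (FreeGroup (Fin (g * r + 1))) (FreeGroup (Fin (r + 1))) g := by
  have e (n : ℕ) (κ : Type) :
      Coprod (CoprodI fun _ : Fin n => PUnit.{1}) (FreeGroup κ) ≃* FreeGroup κ := by
    have : Unique (CoprodI fun _ : Fin n => PUnit.{1}) :=
      ⟨⟨1⟩, fun x => by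
        induction x using CoprodI.induction_on with
        | one => rfl
        | of i m => exact map_one _
        | mul x y hx hy => rw [hx, hy]; exact mul_one _⟩
    exact (MulEquiv.coprodCongr (MulEquiv.ofUnique : _ ≃* PUnit.{1}) (MulEquiv.refl _)).trans
      (MulEquiv.punitCoprod _)
  exact ((coprodI_freeGroup PUnit.{1} 0 r hg).congr_left (e _ _).symm).congr_right (e _ _)

end EmbedsWithIndex

/-! ### Matching the numerical invariants -/

open Monoid in
/-- `(F_{a+1} × F_{b+1}) ∗ (F_{p+1} × F_{q+1})` contains with finite index a free product of `n`
copies of `F_{x+1} × F_{y+1}` and a free group of rank `r`, where `x` and `y` are suitable common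
multiples of `a, p` and of `b, q`, and `n` and `r` depend only on `x`, `y` and `a * b + p * q`. -/
theorem exists_embedsWithIndex_freeProdOfProducts {a b p q u v x y n r : ℕ}
    (ha : 0 < a) (hb : 0 < b) (hp : 0 < p) (hq : 0 < q) (hu : 0 < u) (hv : 0 < v)
    (hx : x = 2 * (a * p * u)) (hy : y = 2 * (b * q * v)) (hn : n = x * y * (a * b + p * q))
    (hr : r + n = (x * y) ^ 2 + 1) :
    ∃ N ≠ 0, EmbedsWithIndex
      (Coprod (CoprodI fun _ : Fin n => FreeGroupOfRank (x + 1) × FreeGroupOfRank (y + 1))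
        (FreeGroup (Fin r)))
      (FreeProdOfProducts (a + 1) (b + 1) (p + 1) (q + 1)) N := by
  have free {z g c : ℕ} (hz : z = g * c) (hg : 0 < g) :
      EmbedsWithIndex (FreeGroupOfRank (z + 1)) (FreeGroupOfRank (c + 1)) g := by
    subst hz; exact EmbedsWithIndex.freeGroup c hg.ne'
  have pair {g g' c c' : ℕ} (hg : 0 < g) (hg' : 0 < g') (hx' : x = g * c) (hy' : y = g' * c') :=
    (free hx' hg).prod (free hy' hg')
  have h₁ := pair (g := 2 * (p * u)) (g' := 2 * (q * v)) (c := a) (c' := b)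
    (by positivity) (by positivity) (by rw [hx]; ring) (by rw [hy]; ring)
  have h₂ := pair (g := 2 * (a * u)) (g' := 2 * (b * v)) (c := p) (c' := q)
    (by positivity) (by positivity) (by rw [hx]; ring) (by rw [hy]; ring)
  -- The factors `2` in `x` and `y` make both indices at least `4`, so the free rank is positive and
  -- a generator can be split off.
  obtain ⟨k, hk⟩ : ∃ k, 2 * (p * u) * (2 * (q * v)) = k + 4 :=
    Nat.exists_eq_add_of_le' (by
      have : 0 < p * u * (q * v) := by positivity
      nlinarith)
  obtain ⟨l, hl⟩ : ∃ l, 2 * (a * u) * (2 * (b * v)) = l + 4 :=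
    Nat.exists_eq_add_of_le' (by
      have : 0 < a * u * (b * v) := by positivity
      nlinarith)
  rw [hk] at h₁
  rw [hl] at h₂
  have h := h₁.coprod h₂ (by simp) (by simp)
  have hrank : (k + 4 - 1) * (l + 4 - 1) = k * l + 3 * k + 3 * l + 8 + 1 := by
    simp only [show k + 4 - 1 = k + 3 from rfl, show l + 4 - 1 = l + 3 from rfl]
    ring
  rw [hrank] at h
  have h' := h.congr_left (MulEquiv.coprodCongr ((coprodICongr finSumFinEquiv.symm
    (MulEquiv.refl _)).trans (coprodISum _ _ _).symm) (MulEquiv.refl _))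
  -- This degree clears the denominators in `xy/(ab) + xy/(pq)`.
  have hg : a * b * (p * q) ≠ 0 := by positivity
  have h'' := (EmbedsWithIndex.coprodI_freeGroup _ _ _ hg).trans h'
  have hxy : x * y = a * b * (k + 4) := by rw [hx, hy, ← hk]; ring
  have hxy' : x * y = p * q * (l + 4) := by rw [hx, hy, ← hl]; ring
  have hn' : a * b * (p * q) * (l + 4 + (k + 4)) = n := by
    calc a * b * (p * q) * (l + 4 + (k + 4))
        = a * b * (p * q * (l + 4)) + p * q * (a * b * (k + 4)) := by ring
      _ = n := by rw [← hxy, ← hxy', hn]; ring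
  have hr' : a * b * (p * q) * (k * l + 3 * k + 3 * l + 8) + 1 = r := by
    have h2 : (x * y) ^ 2 = a * b * (k + 4) * (p * q * (l + 4)) := by
      rw [sq]; nth_rw 1 [hxy]; rw [hxy']
    rw [h2, ← hn'] at hr
    apply Nat.add_right_cancel (m := a * b * (p * q) * (l + 4 + (k + 4)))
    rw [hr]; ring
  rw [hn', hr'] at h''
  exact ⟨_, by positivity, h''⟩

theorem mainTheorem9 (a b p q c d s t : ℕ)
    (ha : 2 ≤ a) (hb : 2 ≤ b) (hp : 2 ≤ p) (hq : 2 ≤ q)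
    (hc : 2 ≤ c) (hd : 2 ≤ d) (hs : 2 ≤ s) (ht : 2 ≤ t)
    (h : ((a : ℤ) - 1) * ((b : ℤ) - 1) + ((p : ℤ) - 1) * ((q : ℤ) - 1)
      = ((c : ℤ) - 1) * ((d : ℤ) - 1) + ((s : ℤ) - 1) * ((t : ℤ) - 1)) :
    AbstractlyCommensurable (FreeProdOfProducts a b p q) (FreeProdOfProducts c d s t) := by
  obtain ⟨a, rfl⟩ := Nat.exists_eq_add_of_le' (one_le_two.trans ha)
  obtain ⟨b, rfl⟩ := Nat.exists_eq_add_of_le' (one_le_two.trans hb)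
  obtain ⟨p, rfl⟩ := Nat.exists_eq_add_of_le' (one_le_two.trans hp)
  obtain ⟨q, rfl⟩ := Nat.exists_eq_add_of_le' (one_le_two.trans hq)
  obtain ⟨c, rfl⟩ := Nat.exists_eq_add_of_le' (one_le_two.trans hc)
  obtain ⟨d, rfl⟩ := Nat.exists_eq_add_of_le' (one_le_two.trans hd)
  obtain ⟨s, rfl⟩ := Nat.exists_eq_add_of_le' (one_le_two.trans hs)
  obtain ⟨t, rfl⟩ := Nat.exists_eq_add_of_le' (one_le_two.trans ht)
  have h : a * b + p * q = c * d + s * t := by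
    push_cast at h
    simp only [add_sub_cancel_right] at h
    exact_mod_cast h
  have ha : 0 < a := by omega
  have hb : 0 < b := by omega
  have hp : 0 < p := by omega
  have hq : 0 < q := by omega
  have hc : 0 < c := by omega
  have hd : 0 < d := by omega
  have hs : 0 < s := by omega
  have ht : 0 < t := by omega
  -- Symmetric in the two groups: `x` is a multiple of `a, p, c, s`, and `y` of `b, q, d, t`.
  set x := 2 * (a * p * (c * s)) with hx
  set y := 2 * (b * q * (d * t)) with hy
  -- Ensures that the free rank `(xy)² + 1 - n` is a natural number.
  have hle : x * y * (a * b + p * q) ≤ (x * y) ^ 2 + 1 := by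
    have h1 : a * b + p * q ≤ 2 * (a * b * (p * q)) := by
      have h3 : 0 < a * b := by positivity
      have h4 : 0 < p * q := by positivity
      nlinarith
    have h2 : 2 * (a * b * (p * q)) ≤ x * y := by
      have : 0 < c * s * (d * t) := by positivity
      calc 2 * (a * b * (p * q)) ≤ 2 * (a * b * (p * q)) * (2 * (c * s * (d * t))) :=
            Nat.le_mul_of_pos_right _ (by positivity)
        _ = x * y := by rw [hx, hy]; ring
    nlinarith [Nat.mul_le_mul_left (x * y) (h1.trans h2)]
  obtain ⟨r, hr⟩ := Nat.exists_eq_add_of_le' hle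
  obtain ⟨M, hM, h₁⟩ := exists_embedsWithIndex_freeProdOfProducts (u := c * s) (v := d * t)
    ha hb hp hq (by positivity) (by positivity) hx hy rfl hr.symm
  obtain ⟨N, hN, h₂⟩ := exists_embedsWithIndex_freeProdOfProducts (u := a * p) (v := b * q)
    hc hd hs ht (by positivity) (by positivity) (hx.trans (by ring)) (hy.trans (by ring))
    (by rw [h]) hr.symm
  exact h₁.abstractlyCommensurable h₂ hM hN
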